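/- Let $X$ be a reflexive real Banach space, let $K\subseteq X$ be nonempty, convex and closed, and let $D\subseteq K$ be self segment-dense in $K$ in the weak topology of $X$; that is, $D$ is weakly dense in $K$ and, for all $x,y\in D$, the set $[x,y]\cap D$ is (weakly) dense in the closed segment $[x,y]$. Let $F:K\times K\rightrightarrows\mathbb{R}$ be a set-valued map. Write $F(x,y)\ge 0$ when $u\ge 0$ for all $u\in F(x,y)$. A set-valued map $T:K\rightrightarrows\mathbb{R}$ is called weakly lower semicontinuous at $x\in K$ if for every open $N\subseteq\mathbb{R}$ with $T(x)\cap N\ne\emptyset$ there is a weak neighbourhood $M$ of $x$ such that $T(x')\cap N\neq\emptyset$ for all $x'\in M\cap K$. It is called convex on $D$ if $\sum_{i=1}^n\lambda_iT(x_i)\subseteq T\left(\sum_{i=1}^n\lambda_ix_i\right)$ (Minkowski sum) for all $n\ge 1$, all $x_1,\dots,x_n\in D$ and all $\lambda_1,\dots,\lambda_n\ge 0$ with $\sum_{i=1}^n\lambda_i=1$ and $\sum_{i=1}^n\lambda_ix_i\in D$. Assume that (i) for every $y\in D$, the map $x\mapsto F(x,y)$ is weakly lower semicontinuous at every point of $K$;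 (ii) for every $x\in K$, the map $y\mapsto F(x,y)$ (defined on $K$) is weakly lower semicontinuous at every point of $K\setminus D$; (iii) for every $x\in K$, the map $y\mapsto F(x,y)$ is convex on $D$; (iv) $F(x,x)\ge 0$ for every $x\in D$; (v) there is $r>0$ such that $\{x\in K:\|x\|\le r\}\neq\emptyset$ and such that for every $x\in K$ with $\|x\|\le r$ there is $y_0\in D$ with $\|y_0\|<r$ and $0\in F(x,y_0)$. Then there is $x_0\in K$ such that $F(x_0,y)\ge 0$ for all $y\in K$. -/

import Mathlib

open Set Topology
open scoped Pointwise

/-- `U ⊆ V` is self segment-dense in the convex set `V`: it is dense in `V`, and for all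
`x, y ∈ U` the set `[x, y] ∩ U` is dense in the closed segment `[x, y]`. The topology is that of
the type `E`; for the weak topology of a normed space take `E` to be its `WeakSpace`. -/
structure IsSelfSegmentDense {E : Type*} [AddCommGroup E] [Module ℝ E] [TopologicalSpace E]
    (U V : Set E) : Prop where
  subset : U ⊆ V
  convex : Convex ℝ V
  dense : V ⊆ closure U
  segment_dense : ∀ x ∈ U, ∀ y ∈ U, segment ℝ x y ⊆ closure (segment ℝ x y ∩ U)

/-- Convexity of a set-valued map `T : D ⇉ ℝ` on a set `D` that need not be convex: whenever a
convex combination of points of `D` lies in `D`, the corresponding Minkowski combination of the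
values is contained in the value at that point. -/
def SetValuedConvexOn {E : Type*} [AddCommGroup E] [Module ℝ E]
    (T : E → Set ℝ) (D : Set E) : Prop :=
  ∀ (n : ℕ) (x : Fin n → E) (l : Fin n → ℝ), (∀ i, x i ∈ D) → (∀ i, 0 ≤ l i) →
    ∑ i, l i = 1 → ∑ i, l i • x i ∈ D → ∑ i, l i • T (x i) ⊆ T (∑ i, l i • x i)

/-- Weak lower semicontinuity at the point `x` of the set-valued map `T : K ⇉ ℝ`: for every open
`N ⊆ ℝ` that meets `T x`, there is a weak neighbourhood of `x` such that `N` meets `T x'` for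
all `x' ∈ K` in this neighbourhood. -/
def WeakLowerSemicontinuousAt {X : Type*} [NormedAddCommGroup X] [NormedSpace ℝ X]
    (T : X → Set ℝ) (K : Set X) (x : X) : Prop :=
  LowerHemicontinuousWithinAt (fun z : WeakSpace ℝ X => T ((toWeakSpace ℝ X).symm z))
    (toWeakSpace ℝ X '' K) (toWeakSpace ℝ X x)

/-! Let `B` be the part of `K` in the ball of radius `r`; by reflexivity it is weakly compact. For
`y` in `D ∩ B` the set `G y` of all `x ∈ B` with `F x y ≥ 0` is weakly closed by (i). Finitely many
`G y` have a common point by the KKM lemma: a point `x ∈ D` in the hull of some `y`'s but in none of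
their `G y` would, by convexity on `D`, give `F x x` a negative value. Testing hull points in `D`
suffices, because `D` is dense in the hulls of its finite subsets
(`convexHull_subset_closure_inter`) and finite unions of the `G y` are closed. Compactness gives
`x₀` for all `y ∈ D ∩ B`. The point `y₀` of (v), joined to a far `y ∈ D`, extends this to `D`;
density and (ii) extend it to `K`.

The KKM lemma rests on Scarf's parity argument, `exists_colourful_dominant`. Ordering lattice points
of a dilated simplex by each coordinate turns its dominant sets into clusters of nearby points, and
a limit over finer lattices yields a statement about closed covers. Applied to a closed shrinking of
the complements, it gives KKM. -/

section Dominant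

/-! ### Dominant sets and Scarf's lemma -/

variable {ι V L : Type*} [LinearOrder L]

/-- A finite set `σ` is dominant for a family of orders on `V` if every point of `V` lies below
all of `σ` for at least one of the orders. The orders are given by rank functions `r i`. -/
def IsDominant (r : ι → V → L) (σ : Finset V) : Prop :=
  ∀ y, ∃ i, ∀ z ∈ σ, r i y ≤ r i z

theorem IsDominant.mono {r : ι → V → L} {σ τ : Finset V} (h : IsDominant r σ) (hτ : τ ⊆ σ) :
    IsDominant r τ := fun y => by
  obtain ⟨i, hi⟩ := h y
  exact ⟨i, fun z hz => hi z (hτ hz)⟩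

variable [Fintype ι] [DecidableEq ι] [DecidableEq V] {r : ι → V → L}

/-- If the minima `m l` for `l ≠ k` exhaust `τ`, then adding to the dominant set `τ` the `r k`-maximal
point `y` among those beyond all these minima gives a larger dominant set. -/
theorem IsDominant.insert_of_maximal {τ : Finset V} (hτ : IsDominant r τ) {m : ι → V}
    (hmin : ∀ i, ∀ z ∈ τ, r i (m i) ≤ r i z) (hmτ : ∀ i, m i ∈ τ) {k : ι}
    (hsurj : ∀ z ∈ τ, ∃ l, l ≠ k ∧ m l = z) {y : V} (hy : ∀ l, l ≠ k → r l (m l) < r l y)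
    (hmax : ∀ y', (∀ l, l ≠ k → r l (m l) < r l y') → r k y' ≤ r k y) :
    y ∉ τ ∧ IsDominant r (insert y τ) := by
  constructor
  · intro hyτ
    obtain ⟨l, hl, rfl⟩ := hsurj y hyτ
    exact lt_irrefl _ (hy l hl)
  · have hky : r k y ≤ r k (m k) := by
      obtain ⟨i, hi⟩ := hτ y
      by_cases hik : i = k
      · exact hik ▸ hi _ (hmτ i)
      · exact absurd (hi _ (hmτ i)) (not_le.2 (hy i hik))
    intro y'
    by_cases h : ∀ l, l ≠ k → r l (m l) < r l y'
    · refine ⟨k, fun z hz => ?_⟩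
      rcases Finset.mem_insert.1 hz with rfl | hz
      · exact hmax y' h
      · exact (hmax y' h).trans (hky.trans (hmin k z hz))
    · push Not at h
      obtain ⟨l, hl, hle⟩ := h
      refine ⟨l, fun z hz => ?_⟩
      rcases Finset.mem_insert.1 hz with rfl | hz
      · exact hle.trans (hy l hl).le
      · exact hle.trans (hmin l z hz)

/-- A dominant set with one element less than there are orders is contained in exactly two dominant
sets with one more element, provided that the two candidate regions for the new point are
nonempty. -/
theorem IsDominant.card_insert_eq_two [Fintype V] (hr : ∀ i, Function.Injective (r i))
    {τ : Finset V} (hτ : IsDominant r τ) (hne : τ.Nonempty) (hcard : τ.card + 1 = Fintype.card ι)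
    (hbeyond : ∀ k, ∃ y, ∀ l, l ≠ k → ∃ z ∈ τ, r l z < r l y) :
    ∃ y₁ y₂, y₁ ≠ y₂ ∧ ∀ y, y ∉ τ ∧ IsDominant r (insert y τ) ↔ y = y₁ ∨ y = y₂ := by
  choose m hmτ hmin using fun i => Finset.exists_min_image τ (r i) hne
  have hb : ∀ k, ∃ y, ∀ l, l ≠ k → r l (m l) < r l y := fun k => by
    obtain ⟨y, hy⟩ := hbeyond k
    refine ⟨y, fun l hl => ?_⟩
    obtain ⟨z, hz, hzy⟩ := hy l hl
    exact (hmin l z hz).trans_lt hzy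
  have hsurj : ∀ z ∈ τ, ∃ l, m l = z := fun z hz => by
    obtain ⟨i, hi⟩ := hτ z
    exact ⟨i, hr i (le_antisymm (hmin i z hz) (hi _ (hmτ i)))⟩
  -- `m` maps the orders onto `τ`, which has one element fewer, so exactly one pair of orders shares
  -- its minimum. Only `a` or `b` can be dropped without losing a point of `τ`.
  obtain ⟨a, -, b, -, hab, hmab⟩ := Finset.exists_ne_map_eq_of_card_lt_of_maps_to
    (s := Finset.univ) (t := τ) (f := m) (by rw [Finset.card_univ]; omega) (fun i _ => hmτ i)
  have hsa : ∀ z ∈ τ, ∃ l, l ≠ a ∧ m l = z := fun z hz => by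
    obtain ⟨l, rfl⟩ := hsurj z hz
    by_cases h : l = a
    · exact ⟨b, hab.symm, by rw [h, hmab]⟩
    · exact ⟨l, h, rfl⟩
  have hsb : ∀ z ∈ τ, ∃ l, l ≠ b ∧ m l = z := fun z hz => by
    obtain ⟨l, rfl⟩ := hsurj z hz
    by_cases h : l = b
    · exact ⟨a, hab, by rw [h, hmab]⟩
    · exact ⟨l, h, rfl⟩
  have hmaxi : ∀ k, ∃ y, (∀ l, l ≠ k → r l (m l) < r l y) ∧
      ∀ y', (∀ l, l ≠ k → r l (m l) < r l y') → r k y' ≤ r k y := fun k => by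
    classical
    obtain ⟨y, hy, hy'⟩ := Finset.exists_max_image
      (Finset.univ.filter fun y => ∀ l, l ≠ k → r l (m l) < r l y) (r k)
      (by obtain ⟨y, hy⟩ := hb k; exact ⟨y, by simpa using hy⟩)
    exact ⟨y, by simpa using hy, fun y' h' => hy' y' (by simpa using h')⟩
  obtain ⟨ya, hya, hyamax⟩ := hmaxi a
  obtain ⟨yb, hyb, hybmax⟩ := hmaxi b
  refine ⟨ya, yb, ?_, fun y => ⟨?_, ?_⟩⟩
  · rintro rfl
    obtain ⟨i, hi⟩ := hτ ya
    by_cases hia : i = a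
    · exact absurd (hi _ (hmτ i)) (not_le.2 (hyb i (hia ▸ hab)))
    · exact absurd (hi _ (hmτ i)) (not_le.2 (hya i hia))
  · rintro ⟨hyτ, hdom⟩
    obtain ⟨k, hk⟩ := hτ y
    have hS : ∀ z ∈ τ, ∃ l, r l (m l) < r l y ∧ m l = z := fun z hz => by
      obtain ⟨i, hi⟩ := hdom z
      have hz' : m i = z :=
        hr i (le_antisymm (hmin i z hz) (hi _ (Finset.mem_insert_of_mem (hmτ i))))
      refine ⟨i, lt_of_le_of_ne (hz' ▸ hi y (Finset.mem_insert_self _ _)) fun h => hyτ ?_, hz'⟩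
      rw [← hr i h]; exact hmτ i
    -- `S` consists of the orders whose minimum survives the insertion of `y`. It still exhausts `τ`
    -- and omits `k`, so by counting it is everything but `k` and `m` is injective on it.
    set S : Finset ι := Finset.univ.filter fun l => r l (m l) < r l y with hSdef
    have hkS : k ∉ S := by simp [hSdef, hk _ (hmτ k)]
    have himg : S.image m = τ := by
      ext z
      constructor
      · intro h
        obtain ⟨l, -, rfl⟩ := Finset.mem_image.1 h
        exact hmτ l
      · intro h
        obtain ⟨l, hl, rfl⟩ := hS z h
        exact Finset.mem_image_of_mem _ (by simpa [hSdef] using hl)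
    have hSsub : S ⊆ Finset.univ.erase k := fun l hl =>
      Finset.mem_erase.2 ⟨fun h => hkS (h ▸ hl), Finset.mem_univ _⟩
    have hek : (Finset.univ.erase k).card + 1 = Fintype.card ι := by
      rw [Finset.card_erase_add_one (Finset.mem_univ k), Finset.card_univ]
    have hle : τ.card ≤ S.card := himg ▸ Finset.card_image_le
    have hSe : S = Finset.univ.erase k := Finset.eq_of_subset_of_card_le hSsub (by omega)
    have hinj : Set.InjOn m S := Finset.card_image_iff.1 (by rw [himg, hSe]; omega)
    have hyk : ∀ l, l ≠ k → r l (m l) < r l y := fun l hl => by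
      have : l ∈ S := by rw [hSe]; simp [hl]
      simpa [hSdef] using this
    have hymax : ∀ y', (∀ l, l ≠ k → r l (m l) < r l y') → r k y' ≤ r k y := fun y' hy' => by
      obtain ⟨i, hi⟩ := hdom y'
      by_cases hik : i = k
      · exact hik ▸ hi y (Finset.mem_insert_self _ _)
      · exact absurd (hi _ (Finset.mem_insert_of_mem (hmτ i))) (not_le.2 (hy' i hik))
    have hkab : k = a ∨ k = b := by
      by_contra! h
      exact hab (hinj (by rw [hSe]; simp [h.1.symm]) (by rw [hSe]; simp [h.2.symm]) hmab)
    rcases hkab with rfl | rfl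
    · exact Or.inl (hr k (le_antisymm (hyamax y hyk) (hymax ya hya)))
    · exact Or.inr (hr k (le_antisymm (hybmax y hyk) (hymax yb hyb)))
  · rintro (rfl | rfl)
    · exact hτ.insert_of_maximal hmin hmτ hsa hya hyamax
    · exact hτ.insert_of_maximal hmin hmτ hsb hyb hybmax

/-- In a set that misses some colour, the subsets with one element less that carry every colour
except `i₀` exactly once come in pairs. -/
theorem even_card_almost_colourful [Fintype V] (c : V → ι) (i₀ : ι) {σ : Finset V}
    (hcard : σ.card = Fintype.card ι) (hσ : σ.image c ≠ Finset.univ) :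
    Even ((σ.powerset.filter fun τ =>
      τ.card + 1 = Fintype.card ι ∧ τ.image c = Finset.univ.erase i₀).card) := by
  set P := σ.powerset.filter fun τ =>
      τ.card + 1 = Fintype.card ι ∧ τ.image c = Finset.univ.erase i₀ with hP
  rcases P.eq_empty_or_nonempty with h | ⟨τ, hτ⟩
  · simp [h]
  have hek : (Finset.univ.erase i₀).card + 1 = Fintype.card ι := by
    rw [Finset.card_erase_add_one (Finset.mem_univ i₀), Finset.card_univ]
  simp only [hP, Finset.mem_filter, Finset.mem_powerset] at hτ
  obtain ⟨hτσ, hτc, hτi⟩ := hτ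
  obtain ⟨y, hyτ, hyσ⟩ : ∃ y, y ∉ τ ∧ insert y τ = σ := by
    obtain ⟨y, hy⟩ := Finset.card_eq_one.1
      (show (σ \ τ).card = 1 by rw [Finset.card_sdiff_of_subset hτσ]; omega)
    have hy' : y ∈ σ \ τ := by simp [hy]
    refine ⟨y, (Finset.mem_sdiff.1 hy').2, ?_⟩
    rw [Finset.insert_eq, ← hy, Finset.sdiff_union_of_subset hτσ]
  -- The extra point `y` must therefore repeat the colour of some `z ∈ τ`; deleting `y` or `z` gives
  -- the only two members of `P`.
  have hcy : c y ≠ i₀ := fun h => hσ (by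
    rw [← hyσ, Finset.image_insert, hτi, h, Finset.insert_erase (Finset.mem_univ _)])
  obtain ⟨z, hz, hzy⟩ : ∃ z ∈ τ, c z = c y := by
    have : c y ∈ τ.image c := by rw [hτi]; simp [hcy]
    simpa using this
  have hzney : z ≠ y := fun h => hyτ (h ▸ hz)
  have hyinσ : y ∈ σ := hyσ ▸ Finset.mem_insert_self _ _
  have hPe : P = {σ.erase y, σ.erase z} := by
    ext ρ
    simp only [hP, Finset.mem_filter, Finset.mem_powerset, Finset.mem_insert, Finset.mem_singleton]
    constructor
    · rintro ⟨hρσ, hρc, hρi⟩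
      have hinj : Set.InjOn c ρ := Finset.card_image_iff.1 (by rw [hρi]; omega)
      have key : ∀ w ∈ σ, w ∉ ρ → ρ = σ.erase w := fun w hw hwρ =>
        Finset.eq_of_subset_of_card_le (Finset.subset_erase.2 ⟨hρσ, hwρ⟩)
          (by rw [Finset.card_erase_of_mem hw]; omega)
      by_cases h1 : y ∈ ρ
      · exact Or.inr (key z (hτσ hz) fun h2 => hzney (hinj h2 h1 hzy))
      · exact Or.inl (key y hyinσ h1)
    · rintro (rfl | rfl)
      · have : σ.erase y = τ := by rw [← hyσ, Finset.erase_insert hyτ]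
        rw [this]; exact ⟨hτσ, hτc, hτi⟩
      · refine ⟨Finset.erase_subset _ _, ?_, ?_⟩
        · rw [Finset.card_erase_add_one (hτσ hz), hcard]
        · rw [← hτi]
          ext i
          simp only [Finset.mem_image, Finset.mem_erase]
          constructor
          · rintro ⟨w, ⟨hwz, hw⟩, rfl⟩
            rw [← hyσ, Finset.mem_insert] at hw
            rcases hw with rfl | hw
            · exact ⟨z, hz, hzy⟩
            · exact ⟨w, hw, rfl⟩
          · rintro ⟨w, hw, rfl⟩
            by_cases hwz : w = z
            · exact ⟨y, ⟨hzney.symm, hyinσ⟩, by rw [hwz, hzy]⟩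
            · exact ⟨w, ⟨hwz, hτσ hw⟩, rfl⟩
  rw [hPe, Finset.card_pair]
  · exact even_two
  · intro h
    have : y ∈ σ.erase z := by simp [hzney.symm, hyinσ]
    rw [← h] at this
    simp at this

/-- The set of all slack points but `s i₀` extends to a dominant set in exactly one way. -/
theorem existsUnique_insert_slack [Fintype V] (hr : ∀ i, Function.Injective (r i))
    {s : ι → V} (hs : ∀ i v, v ≠ s i → r i (s i) < r i v)
    (hs' : ∀ i j v, i ≠ j → v ∉ range s → r i v < r i (s j)) (i₀ : ι)
    (hsinj : Function.Injective s) :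
    ∃ y₀, ∀ y, y ∉ (Finset.univ.erase i₀).image s ∧
      IsDominant r (insert y ((Finset.univ.erase i₀).image s)) ↔ y = y₀ := by
  set τ := (Finset.univ.erase i₀).image s with hτ
  have hmem : ∀ {v}, v ∈ τ ↔ ∃ l, l ≠ i₀ ∧ s l = v := by simp [hτ]
  have hs0 : s i₀ ∉ τ := by
    rw [hmem]
    rintro ⟨l, hl, h⟩
    exact hl (hsinj h)
  -- A point outside `τ` lies above `s l` in each order `l ≠ i₀`, so only order `i₀` can witness
  -- dominance for it. This forces the added point to be the maximum for that order.
  obtain ⟨y₀, hy₀, hmax⟩ := Finset.exists_max_image τᶜ (r i₀) ⟨s i₀, by simpa using hs0⟩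
  rw [Finset.mem_compl] at hy₀
  have hlt : ∀ {y}, y ∉ τ → ∀ l, l ≠ i₀ → r l (s l) < r l y := fun hy l hl =>
    hs l _ fun h => hy (hmem.2 ⟨l, hl, h.symm⟩)
  refine ⟨y₀, fun y => ⟨?_, ?_⟩⟩
  · rintro ⟨hy, hdom⟩
    obtain ⟨i, hi⟩ := hdom y₀
    have hii : i = i₀ := by
      by_contra h
      exact absurd (hi (s i) (Finset.mem_insert_of_mem (hmem.2 ⟨i, h, rfl⟩)))
        (not_le.2 (hlt hy₀ i h))
    subst hii
    exact hr i (le_antisymm (hmax y (Finset.mem_compl.2 hy)) (hi y (Finset.mem_insert_self _ _)))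
  · rintro rfl
    refine ⟨hy₀, fun y' => ?_⟩
    by_cases hy' : y' ∈ τ
    · obtain ⟨l, hl, rfl⟩ := hmem.1 hy'
      refine ⟨l, fun z hz => ?_⟩
      by_cases hzl : z = s l
      · rw [hzl]
      · exact (hs l z hzl).le
    · refine ⟨i₀, fun z hz => ?_⟩
      rcases Finset.mem_insert.1 hz with rfl | hz
      · exact hmax y' (Finset.mem_compl.2 hy')
      · obtain ⟨l, hl, rfl⟩ := hmem.1 hz
        by_cases hyr : y' ∈ range s
        · obtain ⟨k, rfl⟩ := hyr
          have hk : k = i₀ := by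
            by_contra h
            exact hy' (hmem.2 ⟨k, h, rfl⟩)
          subst hk
          exact (hs k (s l) fun h => hl (hsinj h)).le
        · exact (hs' i₀ l y' hl.symm hyr).le

/-- **Scarf's lemma** in the form of Sperner's lemma for dominant sets: if each order `i` has a
slack point `s i` as its minimum and the other slack points above all ordinary points, then every
colouring that gives `s i` the colour `i` has a dominant set carrying each colour once. -/
theorem exists_colourful_dominant [Fintype V] [Nontrivial ι] (hr : ∀ i, Function.Injective (r i))
    {s : ι → V} (hs : ∀ i v, v ≠ s i → r i (s i) < r i v)
    (hs' : ∀ i j v, i ≠ j → v ∉ range s → r i v < r i (s j))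
    (c : V → ι) (hc : ∀ i, c (s i) = i) :
    ∃ σ : Finset V, σ.card = Fintype.card ι ∧ IsDominant r σ ∧ σ.image c = Finset.univ := by
  classical
  by_contra! hno
  obtain ⟨i₀⟩ := (inferInstance : Nonempty ι)
  have hsinj : Function.Injective s := fun i j h => by rw [← hc i, ← hc j, h]
  have hek : (Finset.univ.erase i₀).card + 1 = Fintype.card ι := by
    rw [Finset.card_erase_add_one (Finset.mem_univ i₀), Finset.card_univ]
  let R : Finset (Finset V) :=
    Finset.univ.filter fun σ => σ.card = Fintype.card ι ∧ IsDominant r σ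
  let A : Finset (Finset V) := Finset.univ.filter fun τ =>
    IsDominant r τ ∧ τ.card + 1 = Fintype.card ι ∧ τ.image c = Finset.univ.erase i₀
  let τ₀ : Finset V := (Finset.univ.erase i₀).image s
  have hτ₀c : τ₀.card + 1 = Fintype.card ι := by
    rw [Finset.card_image_of_injective _ hsinj, hek]
  obtain ⟨y₀, hy₀⟩ := existsUnique_insert_slack hr hs hs' i₀ hsinj
  have hτ₀ : τ₀ ∈ A := by
    refine Finset.mem_filter.2 ⟨Finset.mem_univ _,
      ((hy₀ y₀).2 rfl).2.mono (Finset.subset_insert _ _), hτ₀c, ?_⟩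
    rw [Finset.image_image]
    have : c ∘ s = id := funext hc
    rw [this, Finset.image_id]
  -- Double counting of inclusions: without a colourful set every `σ ∈ R` contributes an even
  -- number, while every `τ ∈ A` contributes two except `τ₀`, which contributes one.
  have hcount := Finset.sum_card_bipartiteAbove_eq_sum_card_bipartiteBelow
    (s := A) (t := R) (fun τ σ => τ ⊆ σ)
  have hR : Even (∑ σ ∈ R, (Finset.bipartiteBelow (fun τ σ => τ ⊆ σ) A σ).card) := by
    refine Finset.even_sum _ fun σ hσ => ?_
    obtain ⟨hσc, hσd⟩ := (Finset.mem_filter.1 hσ).2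
    refine (congrArg (fun P : Finset (Finset V) => Even P.card) ?_).mpr
      (even_card_almost_colourful c i₀ hσc (hno σ hσc hσd))
    ext τ
    simp only [Finset.bipartiteBelow, A, Finset.mem_filter, Finset.mem_univ, true_and,
      Finset.mem_powerset]
    exact ⟨fun h => ⟨h.2, h.1.2⟩, fun h => ⟨⟨hσd.mono h.1, h.2⟩, h.1⟩⟩
  have hins : ∀ τ : Finset V, τ.card + 1 = Fintype.card ι → ∀ σ,
      σ ∈ Finset.bipartiteAbove (fun τ σ => τ ⊆ σ) R τ ↔
        ∃ y, (y ∉ τ ∧ IsDominant r (insert y τ)) ∧ insert y τ = σ := fun τ hτc σ => by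
    simp only [Finset.bipartiteAbove, R, Finset.mem_filter, Finset.mem_univ, true_and]
    constructor
    · rintro ⟨⟨hσc, hσd⟩, hτσ⟩
      obtain ⟨y, hy⟩ := Finset.card_eq_one.1
        (show (σ \ τ).card = 1 by rw [Finset.card_sdiff_of_subset hτσ]; omega)
      have hy' : y ∈ σ \ τ := by simp [hy]
      have hyσ : insert y τ = σ := by
        rw [Finset.insert_eq, ← hy, Finset.sdiff_union_of_subset hτσ]
      exact ⟨y, ⟨(Finset.mem_sdiff.1 hy').2, hyσ ▸ hσd⟩, hyσ⟩
    · rintro ⟨y, ⟨hy, hd⟩, rfl⟩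
      exact ⟨⟨by rw [Finset.card_insert_of_notMem hy, hτc], hd⟩, Finset.subset_insert _ _⟩
  have h0 : (Finset.bipartiteAbove (fun τ σ => τ ⊆ σ) R τ₀).card = 1 := by
    refine Finset.card_eq_one.2 ⟨insert y₀ τ₀, ?_⟩
    ext σ
    rw [hins τ₀ hτ₀c, Finset.mem_singleton]
    constructor
    · rintro ⟨y, hy, rfl⟩
      rw [(hy₀ y).1 hy]
    · rintro rfl
      exact ⟨y₀, (hy₀ y₀).2 rfl, rfl⟩
  have h2 : ∀ τ ∈ A.erase τ₀,
      Even (Finset.bipartiteAbove (fun τ σ => τ ⊆ σ) R τ).card := fun τ hτ => by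
    obtain ⟨hττ₀, hτA⟩ := Finset.mem_erase.1 hτ
    obtain ⟨hτd, hτc, hτi⟩ := (Finset.mem_filter.1 hτA).2
    have hcard := Fintype.one_lt_card (α := ι)
    -- With slack points only, the colours would force `τ = τ₀`. An ordinary point `v` puts the
    -- slack point `s k` beyond `τ` in all orders but `k`, so the candidate regions are nonempty.
    obtain ⟨v, hvτ, hv⟩ : ∃ v ∈ τ, v ∉ range s := by
      by_contra! h
      refine hττ₀ (Finset.eq_of_subset_of_card_le (fun v hv => ?_) (by omega))
      obtain ⟨l, rfl⟩ := h v hv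
      refine Finset.mem_image_of_mem _ ?_
      rw [← hτi, ← hc l]
      exact Finset.mem_image_of_mem _ hv
    obtain ⟨y₁, y₂, hne, hy⟩ := hτd.card_insert_eq_two hr ⟨v, hvτ⟩ hτc
      fun k => ⟨s k, fun l hl => ⟨v, hvτ, hs' l k v hl hv⟩⟩
    have : Finset.bipartiteAbove (fun τ σ => τ ⊆ σ) R τ = {insert y₁ τ, insert y₂ τ} := by
      ext σ
      rw [hins τ hτc, Finset.mem_insert, Finset.mem_singleton]
      constructor
      · rintro ⟨y, hy', rfl⟩
        rcases (hy y).1 hy' with rfl | rfl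
        · exact Or.inl rfl
        · exact Or.inr rfl
      · rintro (rfl | rfl)
        · exact ⟨y₁, (hy y₁).2 (Or.inl rfl), rfl⟩
        · exact ⟨y₂, (hy y₂).2 (Or.inr rfl), rfl⟩
    rw [this, Finset.card_pair]
    · exact even_two
    · intro h
      have h1 : y₁ ∈ insert y₂ τ := h ▸ Finset.mem_insert_self _ _
      rcases Finset.mem_insert.1 h1 with h1 | h1
      · exact hne h1
      · exact ((hy y₁).2 (Or.inl rfl)).1 h1
  rw [← hcount, ← Finset.add_sum_erase _ _ hτ₀, h0] at hR
  have := Finset.even_sum _ h2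
  rw [Nat.even_add] at hR
  exact absurd (hR.2 this) (by decide)

end Dominant

/-! ### From lattice colourings to the KKM lemma on the simplex -/

section Covers

variable {ι : Type*} [Fintype ι]

/-- For a colouring of the lattice points of a dilated simplex there is a set of lattice points
such that each index is the colour of a point of the set, or has small coordinates on the set. -/
theorem exists_colourful_lattice_points [DecidableEq ι] [Nontrivial ι] (N : ℕ)
    (c : (ι → ℕ) → ι) :
    ∃ A : Finset (ι → ℕ), A.Nonempty ∧ (∀ p ∈ A, ∑ i, p i = N) ∧
      (∀ p ∈ A, ∀ q ∈ A, ∀ i, p i ≤ q i + Fintype.card ι) ∧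
      ∀ i, (∀ p ∈ A, p i ≤ Fintype.card ι) ∨ ∃ p ∈ A, c p = i := by
  classical
  let G : Finset (ι → ℕ) := Finset.piAntidiag Finset.univ N
  have hG : ∀ p, p ∈ G ↔ ∑ i, p i = N := fun p => by simp [G]
  let V := (G : Type _) ⊕ ι
  let e : V ≃ Fin (Fintype.card V) := Fintype.equivFin V
  -- Lattice points take values from 1 to `N + 1`, leaving 0 for the slack point of order `i` and `N
  -- + 2` for the others. The enumeration `e` breaks ties.
  let h : ι → V → ℕ := fun i => Sum.elim (fun p => p.1 i + 1) fun j => if j = i then 0 else N + 2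
  let r : ι → V → ℕ ×ₗ Fin (Fintype.card V) := fun i v => toLex (h i v, e v)
  have hr : ∀ i, Function.Injective (r i) := fun i v w hvw => by
    have := congrArg (fun x => (ofLex x).2) hvw
    exact e.injective this
  have hlt : ∀ i v w, h i v < h i w → r i v < r i w := fun i v w hvw =>
    Prod.Lex.toLex_lt_toLex.2 (Or.inl hvw)
  have hle : ∀ i v w, r i v ≤ r i w → h i v ≤ h i w := fun i v w hvw =>
    not_lt.1 fun hh => absurd hvw (not_le.2 (hlt i w v hh))
  have hpN : ∀ (p : G) i, p.1 i ≤ N := fun p i => by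
    rw [← (hG p.1).1 p.2]
    exact Finset.single_le_sum (f := p.1) (fun _ _ => Nat.zero_le _) (Finset.mem_univ i)
  obtain ⟨σ, hσc, hσd, hσi⟩ := exists_colourful_dominant (r := r) hr (s := Sum.inr)
    (fun i v hv => hlt _ _ _ (by
      rcases v with p | j
      · simp [h]
      · have : j ≠ i := fun hh => hv (hh ▸ rfl)
        simp [h, this]))
    (fun i j v hij hv => hlt _ _ _ (by
      rcases v with p | k
      · have := hpN p i
        simp only [h, Sum.elim_inl, Sum.elim_inr, if_neg hij.symm]
        omega
      · exact absurd ⟨k, rfl⟩ hv))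
    (Sum.elim (fun p => c p.1) id) (fun i => rfl)
  let A : Finset (ι → ℕ) := σ.toLeft.image Subtype.val
  have hA : ∀ p, p ∈ A ↔ ∃ hp : p ∈ G, (Sum.inl ⟨p, hp⟩ : V) ∈ σ := fun p => by
    simp [A]
  have hAsum : ∀ p ∈ A, ∑ i, p i = N := fun p hp => by
    obtain ⟨hp, -⟩ := (hA p).1 hp
    exact (hG p).1 hp
  let J : Finset ι := Finset.univ.filter fun i => (Sum.inr i : V) ∉ σ
  have hJmem : ∀ i, i ∈ J ↔ (Sum.inr i : V) ∉ σ := fun i => by simp [J]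
  have hcol : ∀ i ∈ J, ∃ p ∈ A, c p = i := fun i hi => by
    have : i ∈ σ.image (Sum.elim (fun p : G => c p.1) id) := by rw [hσi]; simp
    obtain ⟨v, hv, hvi⟩ := Finset.mem_image.1 this
    rcases v with p | j
    · exact ⟨p.1, (hA _).2 ⟨p.2, hv⟩, hvi⟩
    · exact absurd ((show j = i from hvi) ▸ hv) ((hJmem i).1 hi)
  have hAne : A.Nonempty := by
    by_contra hemp
    have hJ : ∀ i, (Sum.inr i : V) ∈ σ := fun i => by
      by_contra hi
      obtain ⟨p, hp, -⟩ := hcol i ((hJmem i).2 hi)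
      exact hemp ⟨p, hp⟩
    obtain ⟨i₀⟩ := (inferInstance : Nonempty ι)
    have hp : Pi.single i₀ N ∈ G := (hG _).2 (by simp)
    obtain ⟨i, hi⟩ := hσd (Sum.inl ⟨_, hp⟩)
    have := hle _ _ _ (hi _ (hJ i))
    simp [h] at this
  choose m hmA hmin using fun i => Finset.exists_min_image A (fun p => p i) hAne
  have hJne : J.Nonempty := by
    by_contra hJ
    rw [Finset.not_nonempty_iff_eq_empty] at hJ
    have hall : ∀ i, (Sum.inr i : V) ∈ σ := fun i => by
      by_contra hi
      have := (hJmem i).2 hi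
      simp [hJ] at this
    obtain ⟨p, hp⟩ := hAne
    obtain ⟨hpG, hp⟩ := (hA p).1 hp
    obtain ⟨i, hi⟩ := hσd (Sum.inl ⟨p, hpG⟩)
    have := hle _ _ _ (hi _ (hall i))
    simp [h] at this
  -- Otherwise some lattice point `q` exceeds the minimum over `A` in every coordinate of `J`, with
  -- the surplus placed at `j`, against dominance. The bound leaves total slack below `Fintype.card
  -- ι`, which controls both the coordinates outside `J` and the spread inside.
  have hsum : N < ∑ i ∈ J, (m i i + 1) := by
    by_contra! hlow
    obtain ⟨j, hj⟩ := hJne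
    let q : ι → ℕ := fun i => (if i ∈ J then m i i + 1 else 0) +
      if i = j then N - ∑ i ∈ J, (m i i + 1) else 0
    have hq : q ∈ G := (hG q).2 (by
      simp only [q, Finset.sum_add_distrib, Finset.sum_ite_mem, Finset.univ_inter,
        Finset.sum_ite_eq', Finset.mem_univ, if_true]
      simp only [Finset.sum_add_distrib] at hlow
      omega)
    obtain ⟨i, hi⟩ := hσd (Sum.inl ⟨q, hq⟩)
    by_cases hiJ : i ∈ J
    · obtain ⟨hp, hpσ⟩ := (hA _).1 (hmA i)
      have := hle _ _ _ (hi _ hpσ)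
      simp [h, q, hiJ] at this
      omega
    · rw [hJmem, not_not] at hiJ
      have := hle _ _ _ (hi _ hiJ)
      simp [h] at this
  have hJcard : J.card ≤ Fintype.card ι := Finset.card_le_univ J
  have hsum' : N < ∑ i ∈ J, m i i + Fintype.card ι := by
    rw [Finset.sum_add_distrib] at hsum
    simp only [Finset.sum_const, smul_eq_mul, mul_one] at hsum
    omega
  have hout : ∀ p ∈ A, ∀ i ∉ J, p i ≤ Fintype.card ι := fun p hp i hi => by
    have h1 : ∑ j ∈ insert i J, p j ≤ N := by
      rw [← hAsum p hp]
      exact Finset.sum_le_sum_of_subset (Finset.subset_univ _)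
    rw [Finset.sum_insert hi] at h1
    have h2 : ∑ j ∈ J, m j j ≤ ∑ j ∈ J, p j := Finset.sum_le_sum fun j _ => hmin j p hp
    omega
  refine ⟨A, hAne, hAsum, fun p hp q hq i => ?_, fun i => ?_⟩
  · by_cases hi : i ∈ J
    · have h1 : ∑ j ∈ J, p j ≤ N := by
        rw [← hAsum p hp]
        exact Finset.sum_le_sum_of_subset (Finset.subset_univ _)
      have h2 : ∑ j ∈ J.erase i, m j j ≤ ∑ j ∈ J.erase i, p j :=
        Finset.sum_le_sum fun j _ => hmin j p hp
      have h3 := Finset.add_sum_erase J p hi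
      have h4 := Finset.add_sum_erase J (fun j => m j j) hi
      have h5 := hmin i q hq
      omega
    · exact (hout p hp i hi).trans (Nat.le_add_left _ _)
  · by_cases hi : i ∈ J
    · exact Or.inr (hcol i hi)
    · exact Or.inl fun p hp => hout p hp i hi

/-- For a closed cover of the standard simplex indexed by its vertices, some point lies in all the
sets whose vertices span the face carrying it. -/
theorem exists_mem_stdSimplex_forall_mem_of_pos [Nonempty ι] {C : ι → Set (ι → ℝ)}
    (hC : ∀ i, IsClosed (C i)) (hcov : ∀ x ∈ stdSimplex ℝ ι, ∃ i, x ∈ C i) :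
    ∃ x ∈ stdSimplex ℝ ι, ∀ i, 0 < x i → x ∈ C i := by
  classical
  rcases subsingleton_or_nontrivial ι with hι | hι
  · obtain ⟨i₀⟩ := (inferInstance : Nonempty ι)
    obtain ⟨i, hi⟩ := hcov _ (single_mem_stdSimplex ℝ i₀)
    exact ⟨_, single_mem_stdSimplex ℝ i₀, fun j _ => Subsingleton.elim i j ▸ hi⟩
  have hscale : ∀ N : ℕ, ∀ p : ι → ℕ, ∑ i, p i = N + 1 →
      (fun i => (p i : ℝ) / (N + 1 : ℕ)) ∈ stdSimplex ℝ ι := fun N p hp => by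
    refine ⟨fun i => by positivity, ?_⟩
    rw [← Finset.sum_div, ← Nat.cast_sum, hp, div_self (by positivity)]
  have happrox : ∀ N : ℕ, ∃ x ∈ stdSimplex ℝ ι, ∀ i,
      x i ≤ Fintype.card ι / (N + 1 : ℕ) ∨ ∃ z ∈ C i, dist z x ≤ Fintype.card ι / (N + 1 : ℕ) := by
    intro N
    have hN : (0 : ℝ) < (N + 1 : ℕ) := by positivity
    obtain ⟨i₀⟩ := (inferInstance : Nonempty ι)
    have hcol : ∀ p : ι → ℕ, ∃ i, ∑ i, p i = N + 1 → (fun i => (p i : ℝ) / (N + 1 : ℕ)) ∈ C i :=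
      fun p => by
        by_cases hp : ∑ i, p i = N + 1
        · obtain ⟨i, hi⟩ := hcov _ (hscale N p hp)
          exact ⟨i, fun _ => hi⟩
        · exact ⟨i₀, fun h => absurd h hp⟩
    choose c hc using hcol
    obtain ⟨A, ⟨p, hp⟩, hsum, hclose, hA⟩ := exists_colourful_lattice_points (N + 1) c
    refine ⟨_, hscale N p (hsum p hp), fun i => ?_⟩
    rcases hA i with h | ⟨q, hq, rfl⟩
    · exact Or.inl (by have := h p hp; gcongr)
    · refine Or.inr ⟨_, hc q (hsum q hq), (dist_pi_le_iff (by positivity)).2 fun j => ?_⟩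
      rw [Real.dist_eq, ← sub_div, abs_div, abs_of_pos hN]
      have h1 : (p j : ℝ) ≤ q j + Fintype.card ι := by exact_mod_cast hclose p hp q hq j
      have h2 : (q j : ℝ) ≤ p j + Fintype.card ι := by exact_mod_cast hclose q hq p hp j
      gcongr
      rw [abs_le]
      constructor <;> linarith
  choose x hxΔ hx using happrox
  obtain ⟨a, haΔ, φ, hφ, hlim⟩ := (isCompact_stdSimplex ℝ ι).tendsto_subseq hxΔ
  have hzero : Filter.Tendsto (fun N => (Fintype.card ι : ℝ) / (φ N + 1 : ℕ)) Filter.atTop (𝓝 0) :=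
    ((tendsto_const_div_atTop_nhds_zero_nat _).comp
      (Filter.tendsto_add_atTop_nat 1)).comp hφ.tendsto_atTop
  refine ⟨a, haΔ, fun i hi => ?_⟩
  rw [← (hC i).closure_eq, Metric.mem_closure_iff]
  intro ε hε
  have hlimi : Filter.Tendsto (fun N => x (φ N) i) Filter.atTop (𝓝 (a i)) :=
    (tendsto_pi_nhds.1 hlim) i
  obtain ⟨N, h1, h2, h3⟩ := ((hzero.eventually_lt hlimi hi).and
    ((hzero.eventually_lt_const (half_pos hε)).and
      (Metric.tendsto_nhds.1 hlim _ (half_pos hε)))).exists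
  rcases hx (φ N) i with h | ⟨z, hz, hzx⟩
  · exact absurd h (not_le.2 h1)
  · refine ⟨z, hz, ?_⟩
    rw [dist_comm]
    calc dist z a ≤ dist z (x (φ N)) + dist (x (φ N)) a := dist_triangle _ _ _
      _ < ε / 2 + ε / 2 := add_lt_add_of_le_of_lt (hzx.trans h2.le) h3
      _ = ε := add_halves ε

/-- **Knaster–Kuratowski–Mazurkiewicz lemma**. -/
theorem exists_mem_stdSimplex_forall_mem [Nonempty ι] {A : ι → Set (ι → ℝ)}
    (hA : ∀ i, IsClosed (A i)) (hcov : ∀ x ∈ stdSimplex ℝ ι, ∃ i, 0 < x i ∧ x ∈ A i) :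
    ∃ x ∈ stdSimplex ℝ ι, ∀ i, x ∈ A i := by
  by_contra! hno
  -- Without a common point the complements of the `A i` cover the simplex. A point lying in the
  -- shrunken `C i` for every `i` in its support avoids all those `A i`, contrary to `hcov`.
  obtain ⟨C, hCcov, hC, hCA⟩ := exists_subset_iUnion_closed_subset
    (isClosed_stdSimplex (𝕜 := ℝ) (ι := ι)) (fun i => (hA i).isOpen_compl)
    (fun _ _ => Set.toFinite _) (fun x hx => by simpa using hno x hx)
  obtain ⟨x, hx, hxC⟩ := exists_mem_stdSimplex_forall_mem_of_pos hC
    (fun x hx => by simpa using hCcov hx)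
  obtain ⟨i, hi, hxi⟩ := hcov x hx
  exact hCA i (hxC i hi) hxi

end Covers

/-! ### KKM in vector spaces and self segment-dense sets -/

section SegmentDense

variable {E : Type*} [AddCommGroup E] [Module ℝ E] [TopologicalSpace E] [ContinuousAdd E]
  [ContinuousSMul ℝ E]

/-- **KKM lemma** for finitely many points in a topological vector space. -/
theorem exists_mem_convexHull_forall_mem {ι : Type*} [Fintype ι] [Nonempty ι] (y : ι → E)
    {G : ι → Set E} (hG : ∀ i, IsClosed (G i))
    (hcov : ∀ J : Set ι, convexHull ℝ (y '' J) ⊆ ⋃ i ∈ J, G i) :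
    ∃ x ∈ convexHull ℝ (range y), ∀ i, x ∈ G i := by
  have hφ : Continuous fun w : ι → ℝ => ∑ i, w i • y i := by fun_prop
  obtain ⟨w, hw, hwG⟩ := exists_mem_stdSimplex_forall_mem (fun i => (hG i).preimage hφ)
    fun w hw => by
      have hmem : ∑ i, w i • y i ∈ convexHull ℝ (y '' {i | 0 < w i}) := by
        have hsum : ∑ i ∈ Finset.univ.filter (fun i => 0 < w i), w i = 1 := by
          rw [Finset.sum_filter_of_ne fun i _ hi => (hw.1 i).lt_of_ne' hi]
          exact hw.2
        rw [← Finset.sum_filter_of_ne (p := fun i => 0 < w i)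
          fun i _ hi => (hw.1 i).lt_of_ne' fun h => hi (by rw [h, zero_smul])]
        exact (convex_convexHull ℝ _).sum_mem (fun i _ => hw.1 i) hsum fun i hi =>
          subset_convexHull ℝ _ (mem_image_of_mem y (Finset.mem_filter.1 hi).2)
      simpa using hcov _ hmem
  refine ⟨_, ?_, hwG⟩
  exact (convex_convexHull ℝ _).sum_mem (fun i _ => hw.1 i) hw.2 fun i _ =>
    subset_convexHull ℝ _ (mem_range_self i)

/-- If segments between points of `D` are approximated by points of `D` inside them, then so are
convex hulls of finite subsets of `D`. -/
theorem convexHull_subset_closure_inter {D : Set E}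
    (hD : ∀ x ∈ D, ∀ y ∈ D, segment ℝ x y ⊆ closure (segment ℝ x y ∩ D)) {S : Set E}
    (hS : S.Finite) (hSD : S ⊆ D) : convexHull ℝ S ⊆ closure (convexHull ℝ S ∩ D) := by
  induction S, hS using Set.Finite.induction_on with
  | empty => simp
  | @insert a S _ _ ih =>
    rcases S.eq_empty_or_nonempty with rfl | hne
    · simp only [insert_empty_eq, convexHull_singleton]
      exact fun x hx => subset_closure ⟨hx, hSD (by simpa using hx)⟩
    rw [convexHull_insert hne]
    intro x hx
    rw [mem_convexJoin] at hx
    obtain ⟨a', rfl, z, hz, hx⟩ := hx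
    obtain ⟨s, t, hs, ht, hst, rfl⟩ := hx
    -- The condition is closed in `z`, so `z` may be taken in `D`, where the segment hypothesis
    -- applies.
    have hcl : IsClosed {z | s • a' + t • z ∈ closure (convexJoin ℝ {a'} (convexHull ℝ S) ∩ D)} :=
      isClosed_closure.preimage (by fun_prop)
    refine closure_minimal ?_ hcl (ih ((subset_insert _ _).trans hSD) hz)
    rintro z ⟨hzS, hzD⟩
    refine closure_mono ?_ (hD a' (hSD (mem_insert _ _)) z hzD ⟨s, t, hs, ht, hst, rfl⟩)
    exact inter_subset_inter_left _ fun w hw => mem_convexJoin.2 ⟨a', rfl, z, hzS, hw⟩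

/-- A dense subset of a nondegenerate segment has points other than `x` arbitrarily close to the
end `x`. -/
theorem exists_mem_of_segment_subset_closure [T2Space E] {D : Set E} {x y : E} (hxy : x ≠ y)
    (h : segment ℝ x y ⊆ closure (segment ℝ x y ∩ D)) {δ : ℝ} (hδ : 0 < δ) (hδ1 : δ ≤ 1) :
    ∃ t, 0 < t ∧ t < δ ∧ (1 - t) • x + t • y ∈ D := by
  have hcont : Continuous fun t : ℝ => (1 - t) • x + t • y := by fun_prop
  have hinj : Function.Injective fun t : ℝ => (1 - t) • x + t • y := fun s t hst => by
    have : (s - t) • (y - x) = 0 := by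
      rw [← sub_eq_zero] at hst
      rw [← hst]
      module
    rcases smul_eq_zero.1 this with h | h
    · exact sub_eq_zero.1 h
    · exact absurd (sub_eq_zero.1 h).symm hxy
  -- Removing the compact image of `{0} ∪ [δ, 1]` leaves a neighbourhood of the point with parameter
  -- `δ / 2`; any point of the segment in it has parameter in `(0, δ)`.
  have hclosed : IsClosed ((fun t : ℝ => (1 - t) • x + t • y) '' ({0} ∪ Icc δ 1)) :=
    ((isCompact_singleton.union isCompact_Icc).image hcont).isClosed
  have hnot : (1 - δ / 2) • x + (δ / 2) • y ∉
      (fun t : ℝ => (1 - t) • x + t • y) '' ({0} ∪ Icc δ 1) := by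
    rintro ⟨t, ht, hteq⟩
    have : t = δ / 2 := hinj hteq
    rcases ht with rfl | ht
    · linarith
    · linarith [ht.1]
  have hmem : (1 - δ / 2) • x + (δ / 2) • y ∈ segment ℝ x y :=
    ⟨1 - δ / 2, δ / 2, by linarith, by linarith, by ring, rfl⟩
  obtain ⟨z, hz, ⟨s, t, hs, ht, hst, rfl⟩, hzD⟩ :=
    mem_closure_iff.1 (h hmem) _ hclosed.isOpen_compl hnot
  obtain rfl : s = 1 - t := by linarith
  have ht' : t ∉ ({0} ∪ Icc δ 1 : Set ℝ) := fun h => hz ⟨t, h, rfl⟩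
  simp only [mem_union, mem_singleton_iff, mem_Icc, not_or, not_and, not_le] at ht'
  refine ⟨t, lt_of_le_of_ne ht (Ne.symm ht'.1), ?_, hzD⟩
  by_contra! hle
  linarith [ht'.2 hle]

end SegmentDense

/-! ### Set-valued maps and the weak topology -/

section SetValued

/-- If a set-valued map that is convex on `D` takes negative values at points of `D`, then so it
does at every point of `D` in their convex hull. -/
theorem SetValuedConvexOn.exists_neg_of_mem_convexHull {E : Type*} [AddCommGroup E] [Module ℝ E]
    {T : E → Set ℝ} {D S : Set E} (hT : SetValuedConvexOn T D) (hSD : S ⊆ D)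
    (hS : ∀ y ∈ S, ∃ u ∈ T y, u < 0) {x : E} (hxD : x ∈ D) (hx : x ∈ convexHull ℝ S) :
    ∃ u ∈ T x, u < 0 := by
  obtain ⟨ι, _, w, z, hw, hw1, hz, rfl⟩ := mem_convexHull_iff_exists_fintype.1 hx
  let e := (Fintype.equivFin ι).symm
  choose u hu hu0 using fun i => hS (z i) (hz i)
  have hsum : ∑ i, w (e i) • z (e i) = ∑ i, w i • z i := e.sum_comp fun i => w i • z i
  have h1 : ∑ i, w (e i) = 1 := by rw [e.sum_comp w, hw1]
  have := hT _ (z ∘ e) (w ∘ e) (fun i => hSD (hz _)) (fun i => hw _) h1 (by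
    simpa only [Function.comp_apply, hsum] using hxD)
  refine ⟨∑ i, w (e i) • u (e i), ?_, ?_⟩
  · rw [← hsum]
    exact this (Set.finsetSum_mem_finsetSum _ _ _ fun i _ => smul_mem_smul_set (hu _))
  · obtain ⟨i, -, hi⟩ := Finset.exists_ne_zero_of_sum_ne_zero (by rw [h1]; exact one_ne_zero)
    refine Finset.sum_neg' (fun i _ => mul_nonpos_of_nonneg_of_nonpos (hw _) (hu0 _).le)
      ⟨i, Finset.mem_univ _, mul_neg_of_pos_of_neg ((hw _).lt_of_ne' hi) (hu0 _)⟩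

/-- A set-valued map convex on `D` maps convex combinations of two values into the value at the
combination. -/
theorem SetValuedConvexOn.add_mem {E : Type*} [AddCommGroup E] [Module ℝ E]
    {T : E → Set ℝ} {D : Set E} (hT : SetValuedConvexOn T D) {x y : E} (hx : x ∈ D) (hy : y ∈ D)
    {s t : ℝ} (hs : 0 ≤ s) (ht : 0 ≤ t) (hst : s + t = 1) (hxy : s • x + t • y ∈ D) {u v : ℝ}
    (hu : u ∈ T x) (hv : v ∈ T y) : s * u + t * v ∈ T (s • x + t • y) := by
  have := hT 2 ![x, y] ![s, t] (by simp [Fin.forall_fin_two, hx, hy])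
    (by simp [Fin.forall_fin_two, hs, ht]) (by simpa [Fin.sum_univ_two]) (by simpa)
  simp only [Fin.sum_univ_two, Matrix.cons_val_zero, Matrix.cons_val_one] at this
  exact this (Set.add_mem_add (smul_mem_smul_set hu) (smul_mem_smul_set hv))

variable {X : Type*} [NormedAddCommGroup X] [NormedSpace ℝ X]

/-- Semicontinuity is tested on the open half-line of negative numbers only; this is what lets
nonnegativity pass to weak limits. -/
theorem WeakLowerSemicontinuousAt.eventually_exists_neg {T : X → Set ℝ} {K : Set X} {x : X}
    (h : WeakLowerSemicontinuousAt T K x) {u : ℝ} (hu : u ∈ T x) (hu0 : u < 0) :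
    ∀ᶠ w in 𝓝 (toWeakSpace ℝ X x), w ∈ toWeakSpace ℝ X '' K →
      ∃ v ∈ T ((toWeakSpace ℝ X).symm w), v < 0 := by
  have := eventually_nhdsWithin_iff.1 (h (Iio 0) ⟨isOpen_Iio, u, by simpa using hu, hu0⟩)
  filter_upwards [this] with w hw hwK
  obtain ⟨-, v, hv, hv0⟩ := hw hwK
  exact ⟨v, hv, hv0⟩

theorem IsClosed.toWeakSpace_image {K : Set X} (hK : IsClosed K) (hconv : Convex ℝ K) :
    IsClosed (toWeakSpace ℝ X '' K) := by
  rw [← closure_eq_iff_isClosed, ← hconv.toWeakSpace_closure ℝ, hK.closure_eq]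

/-- Banach–Alaoglu gives compactness in the bidual; reflexivity ensures that no limit point lies
outside `X`. -/
theorem isCompact_toWeakSpace_image
    (hX : Function.Surjective (NormedSpace.inclusionInDoubleDual ℝ X)) {K : Set X}
    (hK : IsClosed K) (hconv : Convex ℝ K) (hb : Bornology.IsBounded K) :
    IsCompact (toWeakSpace ℝ X '' K) := by
  rw [← (hK.toWeakSpace_image hconv).closure_eq]
  refine NormedSpace.isCompact_closure_of_isBounded ℝ X _ ?_ ?_
  · rwa [preimage_image_eq _ (toWeakSpace ℝ X).injective]
  · have : Function.Surjective (NormedSpace.inclusionInDoubleDualWeak ℝ X) := hX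
    rw [this.range_eq]
    exact subset_univ _

end SetValued

/-! ### The equilibrium point -/

theorem theorem4p5 {X : Type*} [NormedAddCommGroup X] [NormedSpace ℝ X] [CompleteSpace X]
    (hX : Function.Surjective (NormedSpace.inclusionInDoubleDual ℝ X))
    (K D : Set X) (hKne : K.Nonempty) (hKconv : Convex ℝ K) (hKclosed : IsClosed K)
    (hD : IsSelfSegmentDense (toWeakSpace ℝ X '' D) (toWeakSpace ℝ X '' K))
    (F : X → X → Set ℝ)
    (h_i : ∀ y ∈ D, ∀ x ∈ K, WeakLowerSemicontinuousAt (fun x' => F x' y) K x)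
    (h_ii : ∀ x ∈ K, ∀ y ∈ K \ D, WeakLowerSemicontinuousAt (fun y' => F x y') K y)
    (h_iii : ∀ x ∈ K, SetValuedConvexOn (fun y => F x y) D)
    (h_iv : ∀ x ∈ D, ∀ u ∈ F x x, 0 ≤ u)
    (h_v : ∃ r : ℝ, 0 < r ∧ (∃ x ∈ K, ‖x‖ ≤ r) ∧
      ∀ x ∈ K, ‖x‖ ≤ r → ∃ y₀ ∈ D, ‖y₀‖ < r ∧ (0 : ℝ) ∈ F x y₀) :
    ∃ x₀ ∈ K, ∀ y ∈ K, ∀ u ∈ F x₀ y, 0 ≤ u := by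
  obtain ⟨r, hr, ⟨xr, hxrK, hxr⟩, hcoer⟩ := h_v
  set e := toWeakSpace ℝ X with he
  have hDK : D ⊆ K := fun x hx => by
    obtain ⟨y, hy, hyx⟩ := hD.subset (mem_image_of_mem e hx)
    exact e.injective hyx ▸ hy
  let B : Set X := K ∩ Metric.closedBall 0 r
  have hBclosed : IsClosed B := hKclosed.inter Metric.isClosed_closedBall
  have hBconv : Convex ℝ B := hKconv.inter (convex_closedBall 0 r)
  have hBcompact : IsCompact (e '' B) := isCompact_toWeakSpace_image hX hBclosed hBconv
    (Metric.isBounded_closedBall.subset inter_subset_right)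
  let G : X → Set (WeakSpace ℝ X) := fun y => e '' {x | x ∈ B ∧ ∀ u ∈ F x y, 0 ≤ u}
  have hGclosed : ∀ y ∈ D, IsClosed (G y) := fun y hy => by
    refine isClosed_of_closure_subset fun w hw => ?_
    obtain ⟨x, hx, rfl⟩ := closure_minimal (image_mono fun x hx => hx.1)
      (hBclosed.toWeakSpace_image hBconv) hw
    refine ⟨x, ⟨hx, fun u hu => ?_⟩, rfl⟩
    by_contra! hu0
    obtain ⟨w, ⟨x', hx', rfl⟩, hw⟩ := ((mem_closure_iff_frequently.1 hw).and_eventually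
      ((h_i y hy x hx.1).eventually_exists_neg hu hu0)).exists
    obtain ⟨v, hv, hv0⟩ := hw (mem_image_of_mem e hx'.1.1)
    exact absurd (hx'.2 v (by simpa [he] using hv)) (not_le.2 hv0)
  have hfin : ∀ S : Finset ↥(D ∩ B), (e '' B ∩ ⋂ y ∈ S, G y).Nonempty := fun S => by
    -- The empty family needs `B` itself to be nonempty, hence `xr`.
    rcases S.eq_empty_or_nonempty with rfl | hS
    · exact ⟨e xr, mem_image_of_mem e ⟨hxrK, by simpa using hxr⟩, by simp⟩
    have : Nonempty S := hS.to_subtype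
    obtain ⟨w, -, hw⟩ := exists_mem_convexHull_forall_mem (fun y : S => e y.1.1)
      (G := fun y => G y.1.1) (fun y => hGclosed _ y.1.2.1) fun J => by
        have hJD : (fun y : S => e y.1.1) '' J ⊆ e '' D := by
          rintro _ ⟨y, -, rfl⟩
          exact mem_image_of_mem e y.1.2.1
        refine (convexHull_subset_closure_inter hD.segment_dense (toFinite _) hJD).trans
          (closure_minimal ?_ ((toFinite J).isClosed_biUnion fun y _ => hGclosed _ y.1.2.1))
        rintro _ ⟨hx, x, hxD, rfl⟩
        by_contra hcon
        simp only [mem_iUnion, not_exists] at hcon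
        have himg : (fun y : S => e y.1.1) '' J = e '' ((fun y : S => y.1.1) '' J) := by
          rw [image_image]
        have hx' : x ∈ convexHull ℝ ((fun y : S => y.1.1) '' J) := by
          rw [himg] at hx
          obtain ⟨x', hx', h⟩ := (e.toLinearMap.image_convexHull _).symm.subset hx
          exact e.injective h ▸ hx'
        have hxB : x ∈ B := convexHull_min (by rintro _ ⟨y, -, rfl⟩; exact y.1.2.2) hBconv hx'
        obtain ⟨u, hu, hu0⟩ := (h_iii x hxB.1).exists_neg_of_mem_convexHull
          (S := (fun y : S => y.1.1) '' J) (by rintro _ ⟨y, -, rfl⟩; exact y.1.2.1)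
          (by
            rintro _ ⟨y, hy, rfl⟩
            by_contra! hpos
            exact hcon y hy ⟨x, ⟨hxB, hpos⟩, rfl⟩) hxD hx'
        exact absurd (h_iv x hxD u hu) (not_le.2 hu0)
    obtain ⟨y₁, hy₁⟩ := hS
    refine ⟨w, image_mono (fun x hx => hx.1) (hw ⟨y₁, hy₁⟩), ?_⟩
    simp only [mem_iInter]
    exact fun y hy => hw ⟨y, hy⟩
  obtain ⟨_, ⟨x₀, hx₀, rfl⟩, hx₀G⟩ := hBcompact.inter_iInter_nonempty
    (fun y : ↥(D ∩ B) => G y) (fun y => hGclosed _ y.2.1) hfin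
  have hball : ∀ y ∈ D, ‖y‖ ≤ r → ∀ u ∈ F x₀ y, 0 ≤ u := fun y hy hyr => by
    obtain ⟨x, hx, hxe⟩ := mem_iInter.1 hx₀G ⟨y, hy, hDK hy, by simpa using hyr⟩
    exact e.injective hxe ▸ hx.2
  have hall : ∀ y ∈ D, ∀ u ∈ F x₀ y, 0 ≤ u := fun y hy u hu => by
    by_cases hyr : ‖y‖ ≤ r
    · exact hball y hy hyr u hu
    push Not at hyr
    obtain ⟨y₀, hy₀, hy₀r, h0⟩ := hcoer x₀ hx₀.1 (by simpa using hx₀.2)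
    have hne : e y₀ ≠ e y := fun h => absurd (e.injective h ▸ hy₀r) (not_lt.2 hyr.le)
    have hpos : 0 < ‖y‖ - ‖y₀‖ := by linarith
    -- The bound `(r - ‖y₀‖) / (‖y‖ - ‖y₀‖)` on `t` is where `(1 - t) * ‖y₀‖ + t * ‖y‖` reaches `r`,
    -- so `z` stays in the ball. As `0 ∈ F x₀ y₀`, convexity puts `t * u` into `F x₀ z`, whose
    -- values are nonnegative.
    obtain ⟨t, ht0, htδ, z, hzD, hz⟩ := exists_mem_of_segment_subset_closure hne
      (hD.segment_dense _ (mem_image_of_mem e hy₀) _ (mem_image_of_mem e hy))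
      (div_pos (sub_pos.2 hy₀r) hpos) ((div_le_one hpos).2 (by linarith))
    obtain rfl : z = (1 - t) • y₀ + t • y := e.injective (by rw [hz, map_add, map_smul, map_smul])
    rw [lt_div_iff₀ hpos] at htδ
    have ht1 : t < 1 := by
      by_contra! h
      nlinarith
    have hzr : ‖(1 - t) • y₀ + t • y‖ ≤ r := by
      refine (norm_add_le _ _).trans ?_
      rw [norm_smul, norm_smul, Real.norm_of_nonneg (by linarith), Real.norm_of_nonneg ht0.le]
      linarith
    have := hball _ hzD hzr _ ((h_iii x₀ hx₀.1).add_mem hy₀ hy (by linarith) ht0.le (by ring)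
      hzD h0 hu)
    rw [mul_zero, zero_add] at this
    exact nonneg_of_mul_nonneg_right this ht0
  refine ⟨x₀, hx₀.1, fun y hy u hu => ?_⟩
  by_cases hyD : y ∈ D
  · exact hall y hyD u hu
  by_contra! hu0
  obtain ⟨w, ⟨y', hy', rfl⟩, hw⟩ := ((mem_closure_iff_frequently.1
    (hD.dense (mem_image_of_mem e hy))).and_eventually
      ((h_ii x₀ hx₀.1 y ⟨hy, hyD⟩).eventually_exists_neg hu hu0)).exists
  obtain ⟨v, hv, hv0⟩ := hw (mem_image_of_mem e (hDK hy'))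
  exact absurd (hall y' hy' v (by simpa [he] using hv)) (not_le.2 hv0)
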